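/- Let $V$ be a finite-dimensional real vector space and let $G$ be a finite subgroup of $\mathrm{GL}(V)$ generated by reflections, a reflection being an element of order $2$ that fixes a hyperplane pointwise. A reflection subgroup of $G$ is a subgroup generated by reflections of $G$; it is of type $I_2(m)$ if it is generated by two reflections whose product has order $m$. Assume that $G$ is of odd type, i.e. that $G$ has no reflection subgroup of type $I_2(m)$ with $m$ even and $m\ge 4$ (in other words, all the entries $m_{ij}>2$ of the Coxeter matrix of $G$ are odd). An involution of $G$ is an element $u\in G$ with $u^2=1$ (so $u=1$ is allowed); its degree is the multiplicity of its eigenvalue $-1$, and $u$ is maximal if no involution of $G$ has larger degree. A cube of $G$ is an abelian reflection subgroup $C$ of $G$; its rank $d$ is the number of reflections in $C$, and its extremity is the unique element of $C$ of degree $d$ (the product of all the reflections in $C$). A cube is called maximal if its extremity is a maximal involution of $G$. Then: 1. If $u$ is an involution of $G$ and $C$, $C'$ are two cubes of $G$ with extremity $u$, there exists $g\in G$ with $gCg^{-1}=C'$; moreover every $g\in G$ with $gCg^{-1}=C'$ centralises $u$. 2. If $C$, $C'$ are two maximal cubes of $G$, there exists $g\in G$ with $gCg^{-1}=C'$. 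-/

import Mathlib

namespace FiniteCoxeter

/-- A reflection of `V`: an element of order `2` fixing (pointwise) a hyperplane. -/
def IsReflection {V : Type*} [AddCommGroup V] [Module ℝ V] (s : V ≃ₗ[ℝ] V) : Prop :=
  orderOf s = 2 ∧ ∃ H : Submodule ℝ V,
    Module.finrank ℝ H + 1 = Module.finrank ℝ V ∧ ∀ x ∈ H, s x = x

/-- The set of the reflections that belong to a subgroup `H` of `GL(V)`. -/
def reflections {V : Type*} [AddCommGroup V] [Module ℝ V] (H : Subgroup (V ≃ₗ[ℝ] V)) :
    Set (V ≃ₗ[ℝ] V) :=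
  {s | s ∈ H ∧ IsReflection s}

/-- `(V, G)` is a Coxeter pair: `G` is a finite subgroup of `GL(V)` generated by reflections. -/
def IsCoxeterPair {V : Type*} [AddCommGroup V] [Module ℝ V] (G : Subgroup (V ≃ₗ[ℝ] V)) : Prop :=
  Finite G ∧ Subgroup.closure (reflections G) = G

/-- `H` is a reflection subgroup of `G`: a subgroup generated by reflections of `G`. -/
def IsReflectionSubgroup {V : Type*} [AddCommGroup V] [Module ℝ V]
    (G H : Subgroup (V ≃ₗ[ℝ] V)) : Prop :=
  H ≤ G ∧ Subgroup.closure (reflections H) = H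

/-- `H` is of type `I₂(m)`: it is generated by two reflections whose product has order `m`.
(An abstract isomorphism with a dihedral group would not do: a group of type `A₁ × A₂` is
abstractly isomorphic to the dihedral group of order 12 without being of type `I₂(6)`.) -/
def IsOfTypeI2 {V : Type*} [AddCommGroup V] [Module ℝ V]
    (H : Subgroup (V ≃ₗ[ℝ] V)) (m : ℕ) : Prop :=
  ∃ s t : V ≃ₗ[ℝ] V, IsReflection s ∧ IsReflection t ∧ orderOf (s * t) = m ∧
    H = Subgroup.closure {s, t}

/-- `G` is of odd type: it has no reflection subgroup of type `I₂(m)` with `m` even, `m ≥ 4`. -/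
def IsOddType {V : Type*} [AddCommGroup V] [Module ℝ V] (G : Subgroup (V ≃ₗ[ℝ] V)) : Prop :=
  ∀ m : ℕ, Even m → 4 ≤ m →
    ¬ ∃ H : Subgroup (V ≃ₗ[ℝ] V), IsReflectionSubgroup G H ∧ IsOfTypeI2 H m

/-- An involution of `G`: an element `u` of `G` with `u² = 1` (the identity is allowed). -/
def IsInvolution {V : Type*} [AddCommGroup V] [Module ℝ V]
    (G : Subgroup (V ≃ₗ[ℝ] V)) (u : V ≃ₗ[ℝ] V) : Prop :=
  u ∈ G ∧ u ^ 2 = 1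

/-- The degree of an involution: the multiplicity of the eigenvalue `-1`. -/
noncomputable def degree {V : Type*} [AddCommGroup V] [Module ℝ V] (u : V ≃ₗ[ℝ] V) : ℕ :=
  Module.finrank ℝ (Module.End.eigenspace (u : V →ₗ[ℝ] V) (-1))

/-- A maximal involution of `G`: an involution whose degree is the largest possible. -/
def IsMaximalInvolution {V : Type*} [AddCommGroup V] [Module ℝ V]
    (G : Subgroup (V ≃ₗ[ℝ] V)) (u : V ≃ₗ[ℝ] V) : Prop :=
  IsInvolution G u ∧ ∀ v : V ≃ₗ[ℝ] V, IsInvolution G v → degree v ≤ degree u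

/-- A cube of `G`: an abelian reflection subgroup of `G`. -/
def IsCube {V : Type*} [AddCommGroup V] [Module ℝ V] (G C : Subgroup (V ≃ₗ[ℝ] V)) : Prop :=
  IsReflectionSubgroup G C ∧ ∀ x ∈ C, ∀ y ∈ C, x * y = y * x

/-- The rank of a cube: the number of its reflections, that is, the cardinality of its base. -/
noncomputable def cubeRank {V : Type*} [AddCommGroup V] [Module ℝ V]
    (C : Subgroup (V ≃ₗ[ℝ] V)) : ℕ :=
  (reflections C).ncard

/-- `u` is the extremity of the cube `C`: the element of `C` whose degree is the rank of `C`. -/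
def IsExtremity {V : Type*} [AddCommGroup V] [Module ℝ V]
    (C : Subgroup (V ≃ₗ[ℝ] V)) (u : V ≃ₗ[ℝ] V) : Prop :=
  u ∈ C ∧ degree u = cubeRank C

/-- A maximal cube of `G`: a cube whose extremity is a maximal involution of `G`. -/
def IsMaximalCube {V : Type*} [AddCommGroup V] [Module ℝ V]
    (G C : Subgroup (V ≃ₗ[ℝ] V)) : Prop :=
  IsCube G C ∧ ∃ u : V ≃ₗ[ℝ] V, IsExtremity C u ∧ IsMaximalInvolution G u

/-- The conjugate subgroup `g C g⁻¹`. -/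
def conjSubgroup {V : Type*} [AddCommGroup V] [Module ℝ V]
    (g : V ≃ₗ[ℝ] V) (C : Subgroup (V ≃ₗ[ℝ] V)) : Subgroup (V ≃ₗ[ℝ] V) :=
  C.map (MulAut.conj g).toMonoidHom

end FiniteCoxeter

/-! In odd type two reflections either commute or have a product of odd order, and then they are
conjugate in the dihedral group they generate. This gives an exchange argument
(`exists_image_conj_eq`). If S and S' are commuting sets of reflections of maximal size, a
reflection s of S is conjugate to some s' in S': otherwise s commutes with all of S' and enlarges
it. Move s to s', then induct inside the reflections that commute with s' and differ from it; the
remaining conjugators fix s'.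

Maximality comes from linear algebra. Distinct commuting reflections fix each other's roots, so
these roots are independent, and a commuting set with roots in E has at most dim E elements. For two
cubes with extremity u, E is the -1-eigenspace of u, which the roots of either cube span. For
maximal cubes, the product of a commuting set negates all its roots, so the maximal degree bounds
its size. -/

namespace FiniteCoxeter

/-! ### Conjugacy of maximal commuting sets of involutions -/

section Group

variable {Γ : Type*} [Group Γ]

theorem conj_mem_of_mem_closure {R : Set Γ} (hR : ∀ r ∈ R, ∀ t ∈ R, r * t * r⁻¹ ∈ R)
    (hinv : ∀ r ∈ R, r * r = 1) {g : Γ} (hg : g ∈ Subgroup.closure R) :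
    ∀ t ∈ R, g * t * g⁻¹ ∈ R := by
  induction hg using Subgroup.closure_induction'' with
  | one => simp
  | mem r hr => exact hR r hr
  | inv_mem r hr =>
    rw [inv_eq_of_mul_eq_one_left (hinv r hr)]
    exact hR r hr
  | mul x y _ _ hx hy =>
    intro t ht
    have := hx _ (hy t ht)
    simpa [mul_assoc] using this

/-- Two involutions whose product has odd order are conjugate in the dihedral group they generate. -/
theorem exists_conj_eq_of_odd_orderOf {s t : Γ} (hs : s * s = 1) (ht : t * t = 1)
    (h : Odd (orderOf (s * t))) : ∃ g ∈ Subgroup.closure {s, t}, g * s * g⁻¹ = t := by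
  obtain ⟨k, hk⟩ := h
  have hs' : s ∈ Subgroup.closure {s, t} := Subgroup.subset_closure (by simp)
  have ht' : t ∈ Subgroup.closure {s, t} := Subgroup.subset_closure (by simp)
  -- Since s inverts st, this element conjugates s to (st)^(2k) s = (st)^(2k+1) t⁻¹ = t.
  refine ⟨(s * t) ^ k * s, mul_mem (pow_mem (mul_mem hs' ht') k) hs', ?_⟩
  have hsi : s⁻¹ = s := inv_eq_of_mul_eq_one_left hs
  have hti : t⁻¹ = t := inv_eq_of_mul_eq_one_left ht
  have h1 : (s * t) ^ (2 * k + 1) = 1 := hk ▸ pow_orderOf_eq_one (s * t)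
  have h2 : SemiconjBy s (s * t)⁻¹ (s * t) := by
    simp [SemiconjBy, hsi, hti, mul_assoc]
  have h3 : s * ((s * t) ^ k)⁻¹ = (s * t) ^ k * s := by
    have := (h2.pow_right k).eq
    rwa [inv_pow] at this
  calc (s * t) ^ k * s * s * ((s * t) ^ k * s)⁻¹
      = (s * t) ^ k * (s * ((s * t) ^ k)⁻¹) := by
        rw [mul_inv_rev, hsi]; simp [mul_assoc, hs]
    _ = (s * t) ^ (2 * k + 1) * t⁻¹ := by
        rw [h3, pow_succ, two_mul, pow_add]; simp [mul_assoc]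
    _ = t := by rw [h1, one_mul, hti]

/-- In a self-normalised set of involutions in which any two noncommuting elements have a product
of odd order, two commuting subsets of maximal cardinality are conjugate. -/
theorem exists_image_conj_eq [DecidableEq Γ] (n : ℕ) :
    ∀ R : Set Γ, (∀ r ∈ R, ∀ t ∈ R, r * t * r⁻¹ ∈ R) → (∀ r ∈ R, r * r = 1) →
      (∀ r ∈ R, ∀ t ∈ R, Commute r t ∨ Odd (orderOf (r * t))) →
      (∀ T : Finset Γ, (T : Set Γ) ⊆ R → (∀ x ∈ T, ∀ y ∈ T, Commute x y) → T.card ≤ n) →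
      ∀ S S' : Finset Γ, (S : Set Γ) ⊆ R → (S' : Set Γ) ⊆ R →
        (∀ x ∈ S, ∀ y ∈ S, Commute x y) → (∀ x ∈ S', ∀ y ∈ S', Commute x y) →
        S.card = n → S'.card = n →
        ∃ g ∈ Subgroup.closure R, S.image (MulAut.conj g) = S' := by
  induction n with
  | zero =>
    intro R _ _ _ _ S S' _ _ _ _ hn hn'
    refine ⟨1, one_mem _, ?_⟩
    rw [Finset.card_eq_zero.1 hn, Finset.card_eq_zero.1 hn', Finset.image_empty]
  | succ n ih =>
    intro R hR hinv hodd hmax S S' hS hS' hc hc' hn hn'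
    obtain ⟨s, hs⟩ : S.Nonempty := Finset.card_pos.1 (by omega)
    have key : ∃ s' ∈ S', ∃ g ∈ Subgroup.closure R, g * s * g⁻¹ = s' := by
      by_contra! hcon
      have hcomm : ∀ t ∈ S', Commute s t := by
        intro t ht
        refine (hodd s (hS hs) t (hS' ht)).resolve_right fun ho => ?_
        obtain ⟨g, hg, e⟩ :=
          exists_conj_eq_of_odd_orderOf (hinv s (hS hs)) (hinv t (hS' ht)) ho
        refine hcon t ht g (Subgroup.closure_mono ?_ hg) e
        rintro x (rfl | rfl)
        exacts [hS hs, hS' ht]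
      have hsS' : s ∉ S' := fun h => hcon s h 1 (one_mem _) (by simp)
      have := hmax (insert s S') (by
        rw [Finset.coe_insert]; exact Set.insert_subset (hS hs) hS') (by
        intro x hx y hy
        rcases Finset.mem_insert.1 hx with rfl | hx' <;>
          rcases Finset.mem_insert.1 hy with rfl | hy'
        exacts [Commute.refl _, hcomm y hy', (hcomm x hx').symm, hc' x hx' y hy'])
      rw [Finset.card_insert_of_notMem hsS'] at this
      omega
    obtain ⟨s', hs', g₀, hg₀, e₀⟩ := key
    set S₁ := S.image (MulAut.conj g₀) with hS₁
    have hs₁ : s' ∈ S₁ := Finset.mem_image.2 ⟨s, hs, by simpa using e₀⟩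
    have hS₁R : (S₁ : Set Γ) ⊆ R := by
      intro x hx
      obtain ⟨y, hy, rfl⟩ := Finset.mem_image.1 hx
      simpa using conj_mem_of_mem_closure hR hinv hg₀ y (hS hy)
    have hc₁ : ∀ x ∈ S₁, ∀ y ∈ S₁, Commute x y := by
      intro x hx y hy
      obtain ⟨x', hx', rfl⟩ := Finset.mem_image.1 hx
      obtain ⟨y', hy', rfl⟩ := Finset.mem_image.1 hy
      exact (hc x' hx' y' hy').map (MulAut.conj g₀)
    have hn₁ : S₁.card = n + 1 := by
      rw [hS₁, Finset.card_image_of_injective _ (MulAut.conj g₀).injective, hn]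
    -- Excluding s' makes the bound drop to n: s' can be added to any commuting subset of R'.
    let R' : Set Γ := {r | r ∈ R ∧ Commute r s' ∧ r ≠ s'}
    have hR'R : R' ⊆ R := fun r hr => hr.1
    have herase : ∀ T : Finset Γ, (T : Set Γ) ⊆ R → (∀ x ∈ T, ∀ y ∈ T, Commute x y) → s' ∈ T →
        ((T.erase s' : Finset Γ) : Set Γ) ⊆ R' := by
      intro T hT hcT hsT x hx
      obtain ⟨hne, hx⟩ := Finset.mem_erase.1 hx
      exact ⟨hT hx, hcT x hx s' hsT, hne⟩
    have hcerase : ∀ T : Finset Γ, (∀ x ∈ T, ∀ y ∈ T, Commute x y) →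
        ∀ x ∈ T.erase s', ∀ y ∈ T.erase s', Commute x y := fun T hT x hx y hy =>
      hT x (Finset.mem_of_mem_erase hx) y (Finset.mem_of_mem_erase hy)
    have hcent : ∀ g ∈ Subgroup.closure R', Commute g s' := by
      intro g hg
      have : Subgroup.closure R' ≤ Subgroup.centralizer {s'} := by
        rw [Subgroup.closure_le]
        intro r hr
        exact Subgroup.mem_centralizer_singleton_iff.2 hr.2.1.eq
      exact Subgroup.mem_centralizer_singleton_iff.1 (this hg)
    obtain ⟨g, hg, e⟩ := ih R'
      (by
        intro r hr t ht
        refine ⟨hR r hr.1 t ht.1, (hr.2.1.mul_left ht.2.1).mul_left hr.2.1.inv_left, fun h => ?_⟩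
        apply ht.2.2
        have h4 : r * t = r * s' := by rw [hr.2.1.eq, ← h]; simp
        exact mul_left_cancel h4)
      (fun r hr => hinv r hr.1) (fun r hr t ht => hodd r hr.1 t ht.1)
      (by
        intro T hT hcT
        have hsT : s' ∉ T := fun h => (hT h).2.2 rfl
        have := hmax (insert s' T) (by
          rw [Finset.coe_insert]; exact Set.insert_subset (hS' hs') (hT.trans hR'R)) (by
          intro x hx y hy
          rcases Finset.mem_insert.1 hx with rfl | hx' <;>
            rcases Finset.mem_insert.1 hy with rfl | hy'
          exacts [Commute.refl _, (hT hy').2.1.symm, (hT hx').2.1, hcT x hx' y hy'])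
        rw [Finset.card_insert_of_notMem hsT] at this
        omega)
      (S₁.erase s') (S'.erase s') (herase S₁ hS₁R hc₁ hs₁) (herase S' hS' hc' hs')
      (hcerase S₁ hc₁) (hcerase S' hc') (by rw [Finset.card_erase_of_mem hs₁, hn₁]; rfl)
      (by rw [Finset.card_erase_of_mem hs', hn']; rfl)
    refine ⟨g * g₀, mul_mem (Subgroup.closure_mono hR'R hg) hg₀, ?_⟩
    have hgs : MulAut.conj g s' = s' := by
      rw [MulAut.conj_apply, (hcent g hg).eq, mul_inv_cancel_right]
    have h5 : S.image (MulAut.conj (g * g₀)) = S₁.image (MulAut.conj g) := by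
      rw [hS₁, Finset.image_image, map_mul]; rfl
    rw [h5, ← Finset.insert_erase hs₁, Finset.image_insert, e, hgs, Finset.insert_erase hs']

end Group

/-! ### Roots of commuting reflections -/

section Reflection

variable {V : Type*} [AddCommGroup V] [Module ℝ V]

/-- `a` is a root of `s`: it is nonzero, `s a = -a`, and `s` moves every vector along `a`. -/
def IsRoot (s : V ≃ₗ[ℝ] V) (a : V) : Prop :=
  a ≠ 0 ∧ s a = -a ∧ ∀ x, ∃ c : ℝ, s x = x + c • a

theorem IsReflection.mul_self {s : V ≃ₗ[ℝ] V} (hs : IsReflection s) : s * s = 1 := by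
  rw [← pow_two, ← hs.1, pow_orderOf_eq_one]

theorem IsReflection.apply_apply {s : V ≃ₗ[ℝ] V} (hs : IsReflection s) (x : V) :
    s (s x) = x := by
  simpa using LinearEquiv.congr_fun hs.mul_self x

theorem IsReflection.exists_isRoot [FiniteDimensional ℝ V] {s : V ≃ₗ[ℝ] V}
    (hs : IsReflection s) : ∃ a, IsRoot s a := by
  have hne : s ≠ 1 := by
    rintro rfl
    simpa using hs.1
  obtain ⟨z, hz⟩ : ∃ z, s z ≠ z := by
    by_contra! h
    exact hne (LinearEquiv.ext h)
  obtain ⟨-, H, hH, hfix⟩ := id hs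
  -- Writing x = h + c z with h in H gives s x - x = c (s z - z).
  refine ⟨s z - z, sub_ne_zero.2 hz, by simp [hs.apply_apply], fun x => ?_⟩
  have hzH : z ∉ H := fun h => hz (hfix z h)
  have htop : H ⊔ Submodule.span ℝ {z} = ⊤ := by
    apply Submodule.eq_top_of_finrank_eq
    have h1 : Module.finrank ℝ H < Module.finrank ℝ (H ⊔ Submodule.span ℝ {z} : Submodule ℝ V) := by
      apply Submodule.finrank_lt_finrank_of_lt
      refine lt_of_le_of_ne le_sup_left fun h => hzH ?_
      rw [h]
      exact Submodule.mem_sup_right (Submodule.mem_span_singleton_self z)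
    have h2 := Submodule.finrank_le (H ⊔ Submodule.span ℝ {z})
    omega
  obtain ⟨h, hh, w, hw, rfl⟩ := Submodule.mem_sup.1 (htop ▸ Submodule.mem_top : x ∈ _)
  obtain ⟨c, rfl⟩ := Submodule.mem_span_singleton.1 hw
  refine ⟨c, ?_⟩
  rw [map_add, map_smul, hfix h hh, smul_sub]
  abel

theorem IsReflection.conj {s : V ≃ₗ[ℝ] V} (hs : IsReflection s) (g : V ≃ₗ[ℝ] V) :
    IsReflection (g * s * g⁻¹) := by
  obtain ⟨h2, H, hH, hfix⟩ := hs
  refine ⟨?_, H.map (g : V →ₗ[ℝ] V), ?_, ?_⟩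
  · have := orderOf_injective (MulAut.conj g).toMonoidHom (MulAut.conj g).injective s
    simpa [h2] using this
  · rwa [LinearEquiv.finrank_map_eq g H]
  · rintro _ ⟨y, hy, rfl⟩
    have : g⁻¹ (g y) = y := g.symm_apply_apply y
    simp [this, hfix y hy]

theorem IsRoot.conj {s : V ≃ₗ[ℝ] V} {a : V} (h : IsRoot s a) (g : V ≃ₗ[ℝ] V) :
    IsRoot (g * s * g⁻¹) (g a) := by
  have e : ∀ y, g⁻¹ (g y) = y := g.symm_apply_apply
  have e' : ∀ y, g (g⁻¹ y) = y := g.apply_symm_apply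
  refine ⟨by simpa using h.1, by simp [e, h.2.1], fun x => ?_⟩
  obtain ⟨c, hc⟩ := h.2.2 (g⁻¹ x)
  refine ⟨c, ?_⟩
  rw [LinearEquiv.mul_apply, LinearEquiv.mul_apply, hc, map_add, map_smul, e']

/-- Distinct commuting reflections fix each other's roots. -/
theorem apply_root_eq_of_commute {s t : V ≃ₗ[ℝ] V} {a b : V} (hs : IsReflection s)
    (ht : IsReflection t) (ha : IsRoot s a) (hb : IsRoot t b) (hc : Commute s t) (hne : s ≠ t) :
    t a = a := by
  have hcx : ∀ x, s (t x) = t (s x) := fun x => LinearEquiv.congr_fun hc.eq x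
  obtain ⟨ha0, hsa, hsx⟩ := ha
  obtain ⟨hb0, htb, htx⟩ := hb
  -- By commutation s also negates t a, while s moves t a only along a.
  obtain ⟨k, hk⟩ : ∃ k : ℝ, t a = k • a := by
    obtain ⟨c, hc⟩ := hsx (t a)
    rw [hcx, hsa, map_neg] at hc
    refine ⟨-c / 2, ?_⟩
    have : (2 : ℝ) • t a = (-c) • a := by
      rw [two_smul, neg_smul]
      linear_combination (norm := module) -hc
    rw [neg_div, neg_smul, div_eq_inv_mul, mul_smul, ← smul_neg, ← neg_smul, ← this, smul_smul]
    norm_num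
  have hk2 : k * k = 1 := by
    have := ht.apply_apply a
    rw [hk, map_smul, hk, smul_smul] at this
    have h0 : (k * k - 1) • a = 0 := by rw [sub_smul, this, one_smul, sub_self]
    linarith [(smul_eq_zero.1 h0).resolve_right ha0]
  rcases mul_self_eq_one_iff.1 hk2 with rfl | rfl
  · rwa [one_smul] at hk
  -- If t a = -a, the roots are proportional, so st fixes a and moves every vector along a. As (st)²
  -- = 1, this forces st = 1, hence s = t.
  exfalso
  rw [neg_one_smul] at hk
  obtain ⟨c, hcb⟩ := htx a
  have hcb' : c • b = (-2 : ℝ) • a := by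
    rw [hk] at hcb
    rw [neg_smul, two_smul]
    linear_combination (norm := module) -hcb
  have hc0 : c ≠ 0 := by
    rintro rfl
    rw [zero_smul] at hcb'
    exact ha0 ((smul_eq_zero.1 hcb'.symm).resolve_left (by norm_num))
  have hba : b = (c⁻¹ * (-2)) • a := by
    rw [mul_smul, ← hcb', smul_smul, inv_mul_cancel₀ hc0, one_smul]
  have hst : ∀ x, s (t x) = x := by
    intro x
    obtain ⟨d, hd⟩ := htx x
    obtain ⟨e, he⟩ := hsx x
    rw [hba, smul_smul] at hd
    obtain ⟨f, hf⟩ : ∃ f : ℝ, s (t x) = x + f • a := by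
      refine ⟨e - d * (c⁻¹ * (-2)), ?_⟩
      rw [hd, map_add, map_smul, he, hsa]
      module
    have h1 : s (t (s (t x))) = x := by
      rw [hcx, hs.apply_apply, ht.apply_apply]
    rw [hf, map_add, map_add, hf, map_smul, map_smul, hk, map_neg, hsa, neg_neg] at h1
    have h2 : (2 * f) • a = 0 := by
      rw [two_mul, add_smul]
      linear_combination (norm := module) h1
    have h3 : f = 0 := by
      have := (smul_eq_zero.1 h2).resolve_right ha0
      linarith
    rw [hf, h3, zero_smul, add_zero]
  apply hne
  ext x
  rw [← hst (s x), ← hcx, hs.apply_apply]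

/-- Applying 1 - t to a linear relation kills every term except that of t, which is doubled. -/
theorem linearIndepOn_root {T : Finset (V ≃ₗ[ℝ] V)} (hT : ∀ s ∈ T, IsReflection s)
    {root : (V ≃ₗ[ℝ] V) → V} (hroot : ∀ s ∈ T, IsRoot s (root s))
    (hc : ∀ s ∈ T, ∀ t ∈ T, Commute s t) : LinearIndepOn ℝ root (T : Set (V ≃ₗ[ℝ] V)) := by
  classical
  rw [linearIndepOn_finset_iff]
  intro c hsum t ht
  have h1 : ∑ s ∈ T, c s • (root s - t (root s)) = 0 := by
    simp_rw [smul_sub, Finset.sum_sub_distrib, ← map_smul, ← map_sum, hsum, map_zero, sub_zero]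
  rw [Finset.sum_eq_single t] at h1
  · rw [(hroot t ht).2.1, sub_neg_eq_add, ← two_smul ℝ, smul_smul] at h1
    have := (smul_eq_zero.1 h1).resolve_right (hroot t ht).1
    linarith
  · intro s hs hne
    rw [apply_root_eq_of_commute (hT s hs) (hT t ht) (hroot s hs) (hroot t ht) (hc s hs t ht) hne,
      sub_self, smul_zero]
  · exact fun h => absurd ht h

theorem card_le_finrank_of_root_mem [FiniteDimensional ℝ V] {T : Finset (V ≃ₗ[ℝ] V)}
    (hT : ∀ s ∈ T, IsReflection s) {root : (V ≃ₗ[ℝ] V) → V} (hroot : ∀ s ∈ T, IsRoot s (root s))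
    (hc : ∀ s ∈ T, ∀ t ∈ T, Commute s t) {E : Submodule ℝ V} (hE : ∀ s ∈ T, root s ∈ E) :
    T.card ≤ Module.finrank ℝ E := by
  have h := linearIndepOn_root hT hroot hc
  have h1 := h.linearIndependent
  have h2 : LinearIndependent ℝ (fun s : T => (⟨root s, hE s s.2⟩ : E)) := by
    apply LinearIndependent.of_comp E.subtype
    exact h1
  simpa using h2.fintype_card_le_finrank

theorem mem_negEigenspace {u : V ≃ₗ[ℝ] V} {x : V} :
    x ∈ Module.End.eigenspace (u : V →ₗ[ℝ] V) (-1) ↔ u x = -x := by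
  simp

/-- The product of a finite set `T` of commuting reflections negates the roots of `T`. -/
theorem exists_involution_neg_root {G : Subgroup (V ≃ₗ[ℝ] V)} {root : (V ≃ₗ[ℝ] V) → V}
    (hroot : ∀ s ∈ reflections G, IsRoot s (root s)) {S : Finset (V ≃ₗ[ℝ] V)}
    (hS : (S : Set (V ≃ₗ[ℝ] V)) ⊆ reflections G) (hc : ∀ s ∈ S, ∀ t ∈ S, Commute s t) :
    ∃ u, IsInvolution G u ∧ ∀ s ∈ S, u (root s) = -root s := by
  classical
  -- Commutation with all of S is carried along so that multiplying by one more reflection still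
  -- gives an involution.
  suffices h : ∀ T : Finset (V ≃ₗ[ℝ] V), T ⊆ S → ∃ u, IsInvolution G u ∧ (∀ s ∈ S, Commute u s) ∧
      ∀ s ∈ S, u (root s) = if s ∈ T then -root s else root s by
    obtain ⟨u, hu, -, h⟩ := h S subset_rfl
    exact ⟨u, hu, fun s hs => by rw [h s hs, if_pos hs]⟩
  intro T
  induction T using Finset.induction_on with
  | empty => exact fun _ => ⟨1, ⟨one_mem G, one_pow 2⟩, fun s _ => Commute.one_left s, by simp⟩
  | insert t T ht ih =>
    intro hTS
    obtain ⟨htS, hTS⟩ := Finset.insert_subset_iff.1 hTS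
    obtain ⟨u, ⟨huG, hu2⟩, hcu, hu⟩ := ih hTS
    refine ⟨t * u, ⟨mul_mem (hS htS).1 huG, ?_⟩, fun s hs => (hc t htS s hs).mul_left (hcu s hs),
      fun s hs => ?_⟩
    · rw [(hcu t htS).symm.mul_pow, hu2, pow_two, (hS htS).2.mul_self, one_mul]
    · rw [LinearEquiv.mul_apply, hu s hs]
      by_cases hst : s = t
      · subst hst
        simp [ht, (hroot s (hS htS)).2.1]
      · have := apply_root_eq_of_commute (hS hs).2 (hS htS).2 (hroot s (hS hs)) (hroot t (hS htS))
          (hc s hs t htS) hst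
        by_cases hsT : s ∈ T <;> simp [hsT, hst, this]

/-! ### Extremities and their -1-eigenspaces -/

/-- An element of a group generated by reflections moves every vector within the root span. -/
theorem apply_sub_mem_span_root {S : Set (V ≃ₗ[ℝ] V)} (hS : ∀ s ∈ S, IsReflection s)
    {root : (V ≃ₗ[ℝ] V) → V} (hroot : ∀ s ∈ S, IsRoot s (root s)) {g : V ≃ₗ[ℝ] V}
    (hg : g ∈ Subgroup.closure S) : ∀ x, g x - x ∈ Submodule.span ℝ (root '' S) := by
  have hmem : ∀ r ∈ S, ∀ x, r x - x ∈ Submodule.span ℝ (root '' S) := by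
    intro r hr x
    obtain ⟨c, hc⟩ := (hroot r hr).2.2 x
    rw [hc, add_sub_cancel_left]
    exact Submodule.smul_mem _ _ (Submodule.subset_span ⟨r, hr, rfl⟩)
  induction hg using Subgroup.closure_induction'' with
  | one => simp
  | mem r hr => exact hmem r hr
  | inv_mem r hr =>
    rw [inv_eq_of_mul_eq_one_left (hS r hr).mul_self]
    exact hmem r hr
  | mul g h _ _ hg hh =>
    intro x
    have := add_mem (hg (h x)) (hh x)
    simpa using this

/-- The `-1`-eigenspace of the extremity of a cube is spanned by the roots of the cube. -/
theorem IsExtremity.negEigenspace_eq [FiniteDimensional ℝ V] {G C : Subgroup (V ≃ₗ[ℝ] V)}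
    [Finite G] (hC : IsCube G C) {root : (V ≃ₗ[ℝ] V) → V}
    (hroot : ∀ s, IsReflection s → IsRoot s (root s)) {u : V ≃ₗ[ℝ] V} (hu : IsExtremity C u) :
    Module.End.eigenspace (u : V →ₗ[ℝ] V) (-1) = Submodule.span ℝ (root '' reflections C) := by
  have hfin : (reflections C).Finite :=
    (Set.toFinite (G : Set (V ≃ₗ[ℝ] V))).subset fun s hs => hC.1.1 hs.1
  -- If u x = -x, then -2x = u x - x lies in the root span; conversely, that span has dimension at
  -- most the rank, which is the degree of u.
  apply Submodule.eq_of_le_of_finrank_le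
  · intro x hx
    rw [mem_negEigenspace] at hx
    have h := apply_sub_mem_span_root (S := reflections C) (fun s hs => hs.2)
      (fun s hs => hroot s hs.2) (g := u) (by rw [hC.1.2]; exact hu.1) x
    rw [hx] at h
    have h2 := Submodule.smul_mem _ (-(1 / 2) : ℝ) h
    have h3 : (-(1 / 2) : ℝ) • (-x - x) = x := by module
    rwa [h3] at h2
  · change _ ≤ degree u
    rw [hu.2, cubeRank]
    have h1 : (root '' reflections C).Finite := hfin.image root
    calc Module.finrank ℝ (Submodule.span ℝ (root '' reflections C))
        ≤ (root '' reflections C).ncard := by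
          have := h1.fintype
          rw [Set.ncard_eq_toFinset_card']
          exact finrank_span_le_card _
      _ ≤ _ := Set.ncard_image_le hfin

/-- For y fixed by u, the vector y - v y is negated by v, hence by u; by commutation it is also
fixed by u, so it vanishes. Thus u and v agree on both eigenspaces of u. -/
theorem eq_of_negEigenspace_eq {u v : V ≃ₗ[ℝ] V} (hu : u ^ 2 = 1) (hv : v ^ 2 = 1)
    (hc : Commute u v) (h : Module.End.eigenspace (u : V →ₗ[ℝ] V) (-1) =
      Module.End.eigenspace (v : V →ₗ[ℝ] V) (-1)) : u = v := by
  have huu : ∀ x, u (u x) = x := fun x => by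
    simpa [pow_two] using LinearEquiv.congr_fun hu x
  have hvv : ∀ x, v (v x) = x := fun x => by
    simpa [pow_two] using LinearEquiv.congr_fun hv x
  have hcx : ∀ x, u (v x) = v (u x) := fun x => LinearEquiv.congr_fun hc.eq x
  have h' : ∀ x, u x = -x ↔ v x = -x := fun x => by
    rw [← mem_negEigenspace, ← mem_negEigenspace, h]
  ext x
  have h1 := (h' (x - u x)).1 (by simp [huu])
  have h2 := (h' (x + u x - v (x + u x))).2 (by simp [hvv])
  simp only [map_sub, map_add, huu, hcx] at h1 h2
  have h3 : (4 : ℝ) • u x = (4 : ℝ) • v x := by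
    linear_combination (norm := module) h2 - (2 : ℝ) • h1
  exact smul_right_injective V (by norm_num : (4 : ℝ) ≠ 0) h3

/-! ### Odd type and conjugacy of cubes -/

theorem IsOddType.commute_or_odd {G : Subgroup (V ≃ₗ[ℝ] V)} [Finite G] (hodd : IsOddType G)
    {s t : V ≃ₗ[ℝ] V} (hs : s ∈ reflections G) (ht : t ∈ reflections G) :
    Commute s t ∨ Odd (orderOf (s * t)) := by
  rw [or_iff_not_imp_right, Nat.not_odd_iff_even]
  intro hev
  have hstG : s * t ∈ G := mul_mem hs.1 ht.1
  -- `orderOf` is 0, an even number, for elements of infinite order; finiteness of G rules this out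
  -- and leaves order 2.
  have hpos : 0 < orderOf (s * t) := by
    have := isOfFinOrder_of_finite (⟨s * t, hstG⟩ : G)
    rw [← Submonoid.isOfFinOrder_coe (H := G.toSubmonoid)] at this
    exact this.orderOf_pos
  have hlt : ¬ 4 ≤ orderOf (s * t) := by
    intro h4
    refine hodd _ hev h4 ⟨Subgroup.closure {s, t}, ⟨?_, ?_⟩, s, t, hs.2, ht.2, rfl, rfl⟩
    · rw [Subgroup.closure_le]
      rintro x (rfl | rfl)
      exacts [hs.1, ht.1]
    · apply le_antisymm
      · rw [Subgroup.closure_le]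
        exact fun r hr => hr.1
      · apply Subgroup.closure_mono
        rintro x (rfl | rfl)
        exacts [⟨Subgroup.subset_closure (by simp), hs.2⟩,
          ⟨Subgroup.subset_closure (by simp), ht.2⟩]
  obtain ⟨k, hk⟩ := hev
  have h2 : orderOf (s * t) = 2 := by omega
  have h3 : (s * t) * (s * t) = 1 := by rw [← pow_two, ← h2, pow_orderOf_eq_one]
  have h4 := eq_inv_of_mul_eq_one_left h3
  rwa [mul_inv_rev, inv_eq_of_mul_eq_one_left hs.2.mul_self,
    inv_eq_of_mul_eq_one_left ht.2.mul_self] at h4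

theorem conj_mem_reflections {G : Subgroup (V ≃ₗ[ℝ] V)} {g s : V ≃ₗ[ℝ] V} (hg : g ∈ G)
    (hs : s ∈ reflections G) : g * s * g⁻¹ ∈ reflections G :=
  ⟨mul_mem (mul_mem hg hs.1) (inv_mem hg), hs.2.conj g⟩

/-- A cube is generated by its reflections, so conjugating these suffices. R stays free because the
two claims restrict the reflections differently. -/
theorem exists_conjSubgroup_eq [DecidableEq (V ≃ₗ[ℝ] V)] {G C C' : Subgroup (V ≃ₗ[ℝ] V)}
    [Finite G] (hodd : IsOddType G) (hC : IsCube G C) (hC' : IsCube G C')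
    {R : Set (V ≃ₗ[ℝ] V)} (hRG : R ⊆ reflections G)
    (hR : ∀ r ∈ R, ∀ t ∈ R, r * t * r⁻¹ ∈ R) (hCR : reflections C ⊆ R) (hCR' : reflections C' ⊆ R)
    (hrank : cubeRank C' = cubeRank C)
    (hmax : ∀ T : Finset (V ≃ₗ[ℝ] V), (T : Set (V ≃ₗ[ℝ] V)) ⊆ R →
      (∀ x ∈ T, ∀ y ∈ T, Commute x y) → T.card ≤ cubeRank C) :
    ∃ g ∈ G, conjSubgroup g C = C' := by
  have hfin : (G : Set (V ≃ₗ[ℝ] V)).Finite := Set.toFinite _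
  have hf : (reflections C).Finite := hfin.subset fun s hs => hC.1.1 hs.1
  have hf' : (reflections C').Finite := hfin.subset fun s hs => hC'.1.1 hs.1
  obtain ⟨g, hg, e⟩ := exists_image_conj_eq (cubeRank C) R hR (fun r hr => (hRG hr).2.mul_self)
    (fun r hr t ht => hodd.commute_or_odd (hRG hr) (hRG ht)) hmax hf.toFinset hf'.toFinset
    (by simpa using hCR) (by simpa using hCR')
    (fun x hx y hy => hC.2 x (hf.mem_toFinset.1 hx).1 y (hf.mem_toFinset.1 hy).1)
    (fun x hx y hy => hC'.2 x (hf'.mem_toFinset.1 hx).1 y (hf'.mem_toFinset.1 hy).1)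
    (Set.ncard_eq_toFinset_card _ hf).symm
    ((Set.ncard_eq_toFinset_card _ hf').symm.trans hrank)
  refine ⟨g, ?_, ?_⟩
  · have : Subgroup.closure R ≤ G := by
      rw [Subgroup.closure_le]
      exact fun r hr => (hRG hr).1
    exact this hg
  · have e' : MulAut.conj g '' reflections C = reflections C' := by
      have := congrArg (fun T : Finset (V ≃ₗ[ℝ] V) => (T : Set (V ≃ₗ[ℝ] V))) e
      simpa using this
    rw [conjSubgroup, ← hC.1.2, MonoidHom.map_closure, ← hC'.1.2, ← e']
    rfl

end Reflection

end FiniteCoxeter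

/-! ### The two conjugacy claims -/

theorem mainTheorem4 {V : Type*} [AddCommGroup V] [Module ℝ V] [FiniteDimensional ℝ V]
    (G : Subgroup (V ≃ₗ[ℝ] V)) (hG : FiniteCoxeter.IsCoxeterPair G)
    (hodd : FiniteCoxeter.IsOddType G) :
    (∀ u : V ≃ₗ[ℝ] V, FiniteCoxeter.IsInvolution G u →
      ∀ C C' : Subgroup (V ≃ₗ[ℝ] V),
        FiniteCoxeter.IsCube G C → FiniteCoxeter.IsExtremity C u →
        FiniteCoxeter.IsCube G C' → FiniteCoxeter.IsExtremity C' u →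
          (∃ g ∈ G, FiniteCoxeter.conjSubgroup g C = C') ∧
          (∀ g ∈ G, FiniteCoxeter.conjSubgroup g C = C' → g * u = u * g)) ∧
    (∀ C C' : Subgroup (V ≃ₗ[ℝ] V),
      FiniteCoxeter.IsMaximalCube G C → FiniteCoxeter.IsMaximalCube G C' →
        ∃ g ∈ G, FiniteCoxeter.conjSubgroup g C = C') := by

  classical
  have hfinG : Finite G := hG.1
  have hex : ∀ s : V ≃ₗ[ℝ] V, ∃ a, FiniteCoxeter.IsReflection s → FiniteCoxeter.IsRoot s a := by
    intro s
    by_cases hs : FiniteCoxeter.IsReflection s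
    · obtain ⟨a, ha⟩ := hs.exists_isRoot
      exact ⟨a, fun _ => ha⟩
    · exact ⟨0, fun h => absurd h hs⟩
  choose root hroot using hex
  refine ⟨fun u hu C C' hC hCu hC' hCu' => ⟨?_, ?_⟩, ?_⟩
  · let E := Module.End.eigenspace (u : V →ₗ[ℝ] V) (-1)
    have hE : E = Submodule.span ℝ (root '' FiniteCoxeter.reflections C) :=
      hCu.negEigenspace_eq hC hroot
    have hE' : E = Submodule.span ℝ (root '' FiniteCoxeter.reflections C') :=
      hCu'.negEigenspace_eq hC' hroot
    -- With all reflections of G the cubes need not be maximal; keeping roots in E bounds commuting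
    -- sets by dim E, the rank of C. R is stable under conjugation by its elements, which move
    -- vectors along roots in E.
    let R : Set (V ≃ₗ[ℝ] V) :=
      {r | r ∈ FiniteCoxeter.reflections G ∧ ∃ a ∈ E, FiniteCoxeter.IsRoot r a}
    refine FiniteCoxeter.exists_conjSubgroup_eq hodd hC hC' (R := R) (fun r hr => hr.1) ?_ ?_ ?_
      (hCu'.2.symm.trans hCu.2) ?_
    · rintro r ⟨hr, b, hb, hrb⟩ t ⟨ht, a, ha, hta⟩
      refine ⟨FiniteCoxeter.conj_mem_reflections hr.1 ht, r a, ?_, hta.conj r⟩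
      obtain ⟨c, hc⟩ := hrb.2.2 a
      rw [hc]
      exact add_mem ha (E.smul_mem c hb)
    · exact fun s hs => ⟨⟨hC.1.1 hs.1, hs.2⟩, root s, hE ▸ Submodule.subset_span ⟨s, hs, rfl⟩,
        hroot s hs.2⟩
    · exact fun s hs => ⟨⟨hC'.1.1 hs.1, hs.2⟩, root s, hE' ▸ Submodule.subset_span ⟨s, hs, rfl⟩,
        hroot s hs.2⟩
    · intro T hT hcT
      rw [← hCu.2]
      have hex : ∀ s : V ≃ₗ[ℝ] V, ∃ a, s ∈ T → a ∈ E ∧ FiniteCoxeter.IsRoot s a := by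
        intro s
        by_cases hs : s ∈ T
        · obtain ⟨-, a, ha⟩ := hT hs
          exact ⟨a, fun _ => ha⟩
        · exact ⟨0, fun h => absurd h hs⟩
      choose a ha using hex
      exact FiniteCoxeter.card_le_finrank_of_root_mem (fun s hs => (hT hs).1.2)
        (fun s hs => (ha s hs).2) hcT (fun s hs => (ha s hs).1)
  · intro g hg hgC
    have hv : g * u * g⁻¹ ∈ C' := by
      rw [← hgC]
      exact ⟨u, hCu.1, rfl⟩
    -- Both elements lie in the abelian group C' and have the same degree, so both are extremities
    -- of C' and share their -1-eigenspace.
    have hcomm : Commute (g * u * g⁻¹) u := hC'.2 _ hv _ hCu'.1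
    have hmap : Module.End.eigenspace ((g * u * g⁻¹ : V ≃ₗ[ℝ] V) : V →ₗ[ℝ] V) (-1) =
        (Module.End.eigenspace (u : V →ₗ[ℝ] V) (-1)).map (g : V →ₗ[ℝ] V) := by
      have e : ∀ y, g⁻¹ (g y) = y := g.symm_apply_apply
      have e' : ∀ y, g (g⁻¹ y) = y := g.apply_symm_apply
      ext x
      rw [Submodule.mem_map, FiniteCoxeter.mem_negEigenspace]
      constructor
      · intro hx
        refine ⟨g⁻¹ x, FiniteCoxeter.mem_negEigenspace.2 (g.injective ?_), e' x⟩
        rw [map_neg, e']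
        exact hx
      · rintro ⟨y, hy, rfl⟩
        have hy' : u y = -y := FiniteCoxeter.mem_negEigenspace.1 hy
        simp [e, hy']
    have hext : FiniteCoxeter.IsExtremity C' (g * u * g⁻¹) := by
      refine ⟨hv, ?_⟩
      rw [FiniteCoxeter.degree, hmap, LinearEquiv.finrank_map_eq g]
      exact hCu'.2
    have heq := FiniteCoxeter.eq_of_negEigenspace_eq (by rw [conj_pow, hu.2]; simp) hu.2 hcomm
      ((hext.negEigenspace_eq hC' hroot).trans (hCu'.negEigenspace_eq hC' hroot).symm)
    exact mul_inv_eq_iff_eq_mul.1 heq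
  · rintro C C' ⟨hC, u, hu, hmax⟩ ⟨hC', u', hu', hmax'⟩
    refine FiniteCoxeter.exists_conjSubgroup_eq hodd hC hC' (R := FiniteCoxeter.reflections G)
      subset_rfl (fun r hr t ht => FiniteCoxeter.conj_mem_reflections hr.1 ht)
      (fun s hs => ⟨hC.1.1 hs.1, hs.2⟩) (fun s hs => ⟨hC'.1.1 hs.1, hs.2⟩) ?_ ?_
    · rw [← hu.2, ← hu'.2]
      exact le_antisymm (hmax.2 u' hmax'.1) (hmax'.2 u hmax.1)
    · intro T hT hcT
      -- The independent roots of T lie in the -1-eigenspace of v, so |T| ≤ deg v ≤ deg u.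
      obtain ⟨v, hv, hvT⟩ := FiniteCoxeter.exists_involution_neg_root
        (fun s hs => hroot s hs.2) hT hcT
      rw [← hu.2]
      refine le_trans ?_ (hmax.2 v hv)
      exact FiniteCoxeter.card_le_finrank_of_root_mem (fun s hs => (hT hs).2)
        (fun s hs => hroot s (hT hs).2) hcT
        (fun s hs => FiniteCoxeter.mem_negEigenspace.2 (hvT s hs))
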